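/- Let $G=(V,E,\sigma)$ be a connected finite graph on $N\ge 1$ vertices (undirected, without loops or multiple edges), each of whose edges is coloured black or red by $\sigma$. Let $G_+$ and $G_-$ be the subgraphs, both on the whole vertex set $V$, formed by the black edges and by the red edges respectively, and let $c(\cdot)$ denote the number of connected components. Fix a weight $s_e>0$ for every black edge $e$. For a real vector $t=(t_e)_{e\ \mathrm{red}}$ let $\Gamma=\Gamma(s,t)$ be the weighted graph on $V$ with symmetric weights $\gamma_{ij}=s_e$ if $e=\{i,j\}$ is a black edge, $\gamma_{ij}=-t_e$ if $e=\{i,j\}$ is a red edge, and $\gamma_{ij}=0$ otherwise. Let $\mathcal L(\Gamma)$ be its Laplacian, $\mathcal L_{ij}=\gamma_{ij}$ for $i\ne j$ and $\mathcal L_{ii}=-\sum_{k\neq i}\gamma_{ik}$, let $\lambda_1=0,\lambda_2,\dots,\lambda_N$ be the eigenvalues of $\mathcal L(\Gamma)$ with multiplicity, and put $$\mathcal M(\Gamma)=\frac{(-1)^{N-1}}{N}\prod_{i=2}^N\lambda_i .$$ Then $t\mapsto\mathcal M(\Gamma(s,t))$ is given, on the space of all real vectors $t$, by a unique real polynomial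 in the variables $t_e$ ($e$ red), the crossing polynomial. For every integer $k\ge 0$, this polynomial contains a monomial of total degree $k$ with nonzero coefficient if and only if $$c(G_+)-1\;\le\; k\;\le\; N-c(G_-).$$ -/

import Mathlib

/-- A weighted graph on the vertex set `V`: a symmetric array of real weights. The edges are the
pairs of nonzero weight. -/
structure WeightedGraph (V : Type*) where
  weight : V → V → ℝ
  symm : ∀ i j, weight i j = weight j i

namespace WeightedGraph

variable {V : Type*} [Fintype V] [DecidableEq V]

/-- The graph Laplacian: `γ i j` off the diagonal and `-∑_{k ≠ i} γ i k` on the diagonal. -/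
def laplacian (Γ : WeightedGraph V) : Matrix V V ℝ :=
  Matrix.of fun i j =>
    if i = j then -∑ k ∈ Finset.univ.erase i, Γ.weight i k else Γ.weight i j

/-- The eigenvalues of the Laplacian, counted with multiplicity. The matrix is real symmetric, so
its characteristic polynomial has all its roots in `ℝ`. -/
noncomputable def eigenvalues (Γ : WeightedGraph V) : Multiset ℝ :=
  Γ.laplacian.charpoly.roots

/-- The value `(-1)^(N-1) / N * ∏_{i=2}^N λ_i` of the crossing polynomial at a weighted graph,
where `λ_1 = 0, λ_2, …, λ_N` are the eigenvalues of the Laplacian: one zero eigenvalue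
is removed from the multiset before the product is taken. -/
noncomputable def crossing (Γ : WeightedGraph V) : ℝ :=
  (-1) ^ (Fintype.card V - 1) / (Fintype.card V : ℝ) * (Γ.eigenvalues.erase 0).prod

end WeightedGraph

/-- The two colors of the edges of a signed graph. -/
inductive EdgeColor where
  | black
  | red

/-- A signed graph on the vertex set `V`: a graph each of whose edges is black or red. -/
structure SignedGraph (V : Type*) where
  graph : SimpleGraph V
  color : graph.edgeSet → EdgeColor

namespace SignedGraph

variable {V : Type*}

/-- The edges of a given color. -/
abbrev EdgeOf (G : SignedGraph V) (c : EdgeColor) : Type _ :=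
  {e : G.graph.edgeSet // G.color e = c}

/-- The subgraph, on all of `V`, whose edges are the edges of a given color. -/
def colorGraph (G : SignedGraph V) (c : EdgeColor) : SimpleGraph V where
  Adj i j := ∃ h : s(i, j) ∈ G.graph.edgeSet, G.color ⟨s(i, j), h⟩ = c
  symm := ⟨fun i j h => by rwa [Sym2.eq_swap] at h⟩
  loopless := ⟨fun i h => by
    obtain ⟨h, -⟩ := h
    exact G.graph.irrefl h⟩

/-- The subgraph `G_+` of black edges. -/
def plus (G : SignedGraph V) : SimpleGraph V := G.colorGraph .black

/-- The subgraph `G_-` of red edges. -/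
def minus (G : SignedGraph V) : SimpleGraph V := G.colorGraph .red

open Classical in
/-- The weight of an unordered pair of vertices: `s e` on a black edge `e`, `-t e` on a red edge
`e`, and `0` on a pair that is not an edge. -/
noncomputable def edgeWeight (G : SignedGraph V) (s : G.EdgeOf .black → ℝ)
    (t : G.EdgeOf .red → ℝ) (e : Sym2 V) : ℝ :=
  if h : e ∈ G.graph.edgeSet then
    match hc : G.color ⟨e, h⟩ with
    | .black => s ⟨⟨e, h⟩, hc⟩
    | .red => -t ⟨⟨e, h⟩, hc⟩
  else 0

/-- The weighted graph with weights `s` on the black edges and `-t` on the red edges. -/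
noncomputable def toWeightedGraph (G : SignedGraph V) (s : G.EdgeOf .black → ℝ)
    (t : G.EdgeOf .red → ℝ) : WeightedGraph V where
  weight i j := G.edgeWeight s t s(i, j)
  symm i j := by rw [Sym2.eq_swap]

/-- `P` is the crossing polynomial of `G` in the red variables `t`, the black weights `s` being
fixed: its value at every real vector `t` is the crossing polynomial of the weighted graph. -/
def IsCrossingPolynomial [Fintype V] [DecidableEq V] (G : SignedGraph V)
    (s : G.EdgeOf .black → ℝ) (P : MvPolynomial (G.EdgeOf .red) ℝ) : Prop :=
  ∀ t : G.EdgeOf .red → ℝ, MvPolynomial.eval t P = (G.toWeightedGraph s t).crossing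

end SignedGraph

/-- The number of connected components of a graph. -/
noncomputable def componentCount {V : Type*} (H : SimpleGraph V) : ℕ :=
  Nat.card H.ConnectedComponent

/-! Write `J` for the all-ones matrix. Since `L` is symmetric and kills the constants, adding `J` to
`-L` replaces the eigenvalue `0` by `N` and keeps the rest, so the crossing value is `det (-L + J) /
N ^ 2` (`crossing_eq`), a polynomial in `t`.

On a ray `t = x τ` with all `τ e < 0`, the matrix is a pencil `A + x B`, where `A` is the shifted
black Laplacian and `B` minus the Laplacian of the red graph with weights `-τ e > 0`. Both are
positive semidefinite, and connectedness makes `A + B` positive definite. Diagonalising them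
together turns the determinant into a positive constant times a product of factors `a i + c i * x`
with `a i, c i ≥ 0`, not both zero. Nothing cancels, so the degrees present run from the corank of
`A`, which is `c(G₊) - 1`, to the rank of `B`, which is `N - c(G₋)`.

This range does not depend on `τ`, and a homogeneous component is nonzero exactly when it is nonzero
at some negative `τ`. -/

open Matrix

/-! ### Simultaneous diagonalisation of semidefinite forms -/

namespace Matrix

variable {n : Type*} [Fintype n] [DecidableEq n]

open scoped MatrixOrder in
theorem PosDef.exists_isUnit_eq_conjTranspose_mul_self {M : Matrix n n ℝ} (hM : M.PosDef) :
    ∃ R : Matrix n n ℝ, IsUnit R ∧ M = Rᴴ * R := by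
  have h0 : (0 : Matrix n n ℝ) ≤ M := hM.posSemidef.nonneg
  have hR : (CFC.sqrt M)ᴴ = CFC.sqrt M := (CFC.sqrt_nonneg M).posSemidef.isHermitian
  have hMR : CFC.sqrt M * CFC.sqrt M = M := CFC.sqrt_mul_sqrt_self M h0
  refine ⟨CFC.sqrt M, ?_, by rw [hR, hMR]⟩
  have hu := hM.isUnit
  rw [← hMR] at hu
  rw [isUnit_iff_isUnit_det] at hu ⊢
  rw [det_mul] at hu
  exact isUnit_of_mul_isUnit_left hu

/-- Two positive semidefinite forms with positive definite sum are simultaneously diagonal in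
some basis. -/
theorem PosSemidef.exists_simultaneous_diagonal {A C : Matrix n n ℝ} (hA : A.PosSemidef)
    (hC : C.PosSemidef) (hAC : (A + C).PosDef) :
    ∃ (Q : Matrix n n ℝ) (a c : n → ℝ), IsUnit Q ∧ (∀ i, 0 ≤ a i) ∧ (∀ i, 0 ≤ c i) ∧
      (∀ i, 0 < a i + c i) ∧ A = Qᴴ * diagonal a * Q ∧ C = Qᴴ * diagonal c * Q := by
  -- In the coordinates given by `R` the sum `A + C` is the identity, so any orthonormal basis
  -- diagonalising `C` also diagonalises `A`, with entries `1 - c i`.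
  obtain ⟨R, hR, hM⟩ := hAC.exists_isUnit_eq_conjTranspose_mul_self
  have hRd : IsUnit R.det := (isUnit_iff_isUnit_det R).1 hR
  have hD : (R⁻¹ᴴ * C * R⁻¹).PosSemidef := hC.conjTranspose_mul_mul_same _
  set D := R⁻¹ᴴ * C * R⁻¹ with hDdef
  have hCD : C = Rᴴ * D * R := by
    have h1 : Rᴴ * R⁻¹ᴴ = 1 := by
      rw [← conjTranspose_mul, nonsing_inv_mul _ hRd, conjTranspose_one]
    calc C = (Rᴴ * R⁻¹ᴴ) * C * (R⁻¹ * R) := by rw [h1, nonsing_inv_mul _ hRd]; simp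
      _ = _ := by simp only [hDdef, Matrix.mul_assoc]
  set U : Matrix n n ℝ := (hD.1.eigenvectorUnitary : Matrix n n ℝ) with hU
  have hUU : U * Uᴴ = 1 := by
    have := Unitary.coe_mul_star_self hD.1.eigenvectorUnitary
    simpa [hU, star_eq_conjTranspose] using this
  set c := hD.1.eigenvalues with hc
  have hDU : D = U * diagonal c * Uᴴ := by
    have := hD.1.spectral_theorem
    rw [Unitary.conjStarAlgAut_apply] at this
    simpa [hU, hc, star_eq_conjTranspose, Function.comp_def] using this
  have hQ : IsUnit (Uᴴ * R) := by
    refine IsUnit.mul ?_ hR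
    exact IsUnit.of_mul_eq_one U (mul_eq_one_comm.1 hUU)
  have hCQ : C = (Uᴴ * R)ᴴ * diagonal c * (Uᴴ * R) := by
    rw [hCD, hDU]; simp only [conjTranspose_mul, conjTranspose_conjTranspose, Matrix.mul_assoc]
  have hAQ : A = (Uᴴ * R)ᴴ * diagonal (fun i => 1 - c i) * (Uᴴ * R) := by
    have h1 : diagonal (fun i => 1 - c i) = 1 - diagonal c := by
      rw [← diagonal_one, diagonal_sub]
    have h2 : (Uᴴ * R)ᴴ * (Uᴴ * R) = A + C := by
      rw [hM]
      calc _ = Rᴴ * (U * Uᴴ) * R := by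
            simp only [conjTranspose_mul, conjTranspose_conjTranspose, Matrix.mul_assoc]
        _ = _ := by rw [hUU, Matrix.mul_one]
    rw [h1, Matrix.mul_sub, Matrix.sub_mul, ← hCQ, Matrix.mul_one, h2, add_sub_cancel_right]
  refine ⟨Uᴴ * R, fun i => 1 - c i, c, hQ, ?_, hD.eigenvalues_nonneg, fun i => by simp, hAQ, hCQ⟩
  rw [hAQ] at hA
  have := hQ.posSemidef_star_left_conjugate_iff.1 hA
  exact posSemidef_diagonal_iff.1 this

theorem rank_conjTranspose_mul_diagonal_mul {Q : Matrix n n ℝ} (hQ : IsUnit Q) (a : n → ℝ) :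
    (Qᴴ * diagonal a * Q).rank = (Finset.univ.filter fun i => a i ≠ 0).card := by
  have hd := (isUnit_iff_isUnit_det Q).1 hQ
  rw [rank_mul_eq_left_of_isUnit_det _ _ hd, rank_mul_eq_right_of_isUnit_det _ _
    (by rw [det_conjTranspose]; exact hd.star), rank_diagonal, Fintype.card_subtype]

end Matrix

/-! ### Coefficients of products of nonnegative linear factors -/

namespace Polynomial

theorem coeff_prod_linear_nonneg {ι : Type*} (s : Finset ι) {a c : ι → ℝ} (ha : ∀ i, 0 ≤ a i)
    (hc : ∀ i, 0 ≤ c i) (k : ℕ) : 0 ≤ (∏ i ∈ s, (C (a i) + C (c i) * X)).coeff k := by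
  classical
  induction s using Finset.induction_on generalizing k with
  | empty => simp only [Finset.prod_empty, coeff_one]; split <;> norm_num
  | insert j s hj ih =>
    rw [Finset.prod_insert hj, add_mul, mul_assoc, coeff_add, coeff_C_mul, coeff_C_mul]
    refine add_nonneg (mul_nonneg (ha j) (ih k)) (mul_nonneg (hc j) ?_)
    cases k with
    | zero => simp
    | succ k => rw [coeff_X_mul]; exact ih k

theorem coeff_prod_linear_ne_zero_iff {ι : Type*} [DecidableEq ι] (s : Finset ι) {a c : ι → ℝ}
    (ha : ∀ i, 0 ≤ a i) (hc : ∀ i, 0 ≤ c i) (hac : ∀ i, 0 < a i + c i) (k : ℕ) :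
    (∏ i ∈ s, (C (a i) + C (c i) * X)).coeff k ≠ 0 ↔
      s.card ≤ k + (s.filter fun i => a i ≠ 0).card ∧ k ≤ (s.filter fun i => c i ≠ 0).card := by
  induction s using Finset.induction_on generalizing k with
  | empty => simp [coeff_one]
  | insert j s hj ih =>
    have hA : (s.filter fun i => a i ≠ 0).card ≤ s.card := Finset.card_filter_le _ _
    -- The interval of degrees for `s` is nonempty; hence its union with its shift by one is again
    -- an interval when both `a j` and `c j` are nonzero.
    have hsum : s.card ≤ (s.filter fun i => a i ≠ 0).card + (s.filter fun i => c i ≠ 0).card := by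
      rw [← Finset.card_union_add_card_inter, ← Finset.filter_or, Finset.filter_true_of_mem]
      · omega
      · intro i _
        by_contra! h
        have := hac i
        simp [h.1, h.2] at this
    have hcard (f : ι → ℝ) : ((insert j s).filter fun i => f i ≠ 0).card =
        (s.filter fun i => f i ≠ 0).card + if f j = 0 then 0 else 1 := by
      rw [Finset.filter_insert]
      split_ifs <;> simp_all
    have hnn := coeff_prod_linear_nonneg s ha hc
    rw [Finset.prod_insert hj, add_mul, mul_assoc, coeff_add, coeff_C_mul, coeff_C_mul,
      hcard a, hcard c, Finset.card_insert_of_notMem hj]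
    have hXn : 0 ≤ (X * ∏ i ∈ s, (C (a i) + C (c i) * X)).coeff k := by
      cases k with
      | zero => simp
      | succ k => rw [coeff_X_mul]; exact hnn k
    have hX : (X * ∏ i ∈ s, (C (a i) + C (c i) * X)).coeff k ≠ 0 ↔
        0 < k ∧ s.card + 1 ≤ k + (s.filter fun i => a i ≠ 0).card ∧
          k ≤ (s.filter fun i => c i ≠ 0).card + 1 := by
      cases k with
      | zero => simp
      | succ k => rw [coeff_X_mul, ih k]; omega
    -- Both summands are nonnegative, so the coefficient is nonzero as soon as one of them is.
    rw [Ne, add_eq_zero_iff_of_nonneg (mul_nonneg (ha j) (hnn k)) (mul_nonneg (hc j) hXn),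
      mul_eq_zero, mul_eq_zero, not_and_or, not_or, not_or, ← Ne, ← Ne, ← Ne, ← Ne, ih k, hX]
    have hj' := hac j
    generalize (s.filter fun i => a i ≠ 0).card = α at hA hsum ⊢
    generalize (s.filter fun i => c i ≠ 0).card = γ at hsum ⊢
    by_cases h1 : a j = 0 <;> by_cases h2 : c j = 0
    · simp [h1, h2] at hj'
    all_goals
      simp only [h1, h2, ne_eq, not_true_eq_false, not_false_eq_true, if_true, if_false,
        true_and, false_and, false_or, or_false]
      omega

end Polynomial

/-- The pencil `A + x C` as a polynomial: its determinant has nonzero coefficients exactly between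
the corank of `A` and the rank of `C`. -/
theorem Matrix.PosSemidef.exists_polynomial_det_add_smul {n : Type*} [Fintype n] [DecidableEq n]
    {A C : Matrix n n ℝ} (hA : A.PosSemidef) (hC : C.PosSemidef) (hAC : (A + C).PosDef) :
    ∃ q : Polynomial ℝ, (∀ x : ℝ, q.eval x = (A + x • C).det) ∧
      ∀ k, q.coeff k ≠ 0 ↔ Fintype.card n ≤ k + A.rank ∧ k ≤ C.rank := by
  obtain ⟨Q, a, c, hQ, ha, hc, hac, hAQ, hCQ⟩ := hA.exists_simultaneous_diagonal hC hAC
  have hd : Q.det ≠ 0 := ((isUnit_iff_isUnit_det Q).1 hQ).ne_zero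
  refine ⟨.C (Q.det * Q.det) * ∏ i, (.C (a i) + .C (c i) * .X), fun x => ?_, fun k => ?_⟩
  · have h : A + x • C = Qᴴ * diagonal (fun i => a i + x * c i) * Q := by
      have : diagonal (fun i => a i + x * c i) = diagonal a + x • diagonal c := by
        rw [← diagonal_smul, diagonal_add]; rfl
      rw [this, Matrix.mul_add, Matrix.add_mul, ← hAQ, Matrix.mul_smul, Matrix.smul_mul, ← hCQ]
    rw [h, det_mul, det_mul, det_diagonal, det_conjTranspose, star_trivial]
    simp only [Polynomial.eval_mul, Polynomial.eval_C, Polynomial.eval_prod, Polynomial.eval_add,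
      Polynomial.eval_X]
    simp only [mul_comm x]
    ring
  · rw [Polynomial.coeff_C_mul, mul_ne_zero_iff_left (mul_ne_zero hd hd),
      Polynomial.coeff_prod_linear_ne_zero_iff _ ha hc hac, hAQ, hCQ,
      rank_conjTranspose_mul_diagonal_mul hQ, rank_conjTranspose_mul_diagonal_mul hQ,
      Finset.card_univ]

/-! ### Restriction of a polynomial to rays -/

namespace MvPolynomial

theorem coeff_aeval_C_mul_X {σ : Type*} (P : MvPolynomial σ ℝ) (τ : σ → ℝ) (k : ℕ) :
    (aeval (fun e => Polynomial.C (τ e) * Polynomial.X) P).coeff k =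
      eval τ (homogeneousComponent k P) := by
  classical
  induction P using MvPolynomial.induction_on' with
  | monomial m r =>
    have h : aeval (fun e => Polynomial.C (τ e) * Polynomial.X) (monomial m r) =
        Polynomial.C (r * m.prod fun e d => τ e ^ d) * Polynomial.X ^ m.degree := by
      simp only [aeval_monomial, Finsupp.prod, mul_pow, Finset.prod_mul_distrib,
        Finset.prod_pow_eq_pow_sum, Finsupp.degree, map_mul, map_prod, map_pow, mul_assoc]
      rfl
    rw [h, Polynomial.coeff_C_mul_X_pow, homogeneousComponent_of_mem (n := m.degree)
      ((mem_homogeneousSubmodule _ _).2 (isHomogeneous_monomial r rfl))]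
    split <;> simp [eval_monomial]
  | add p q hp hq => simp [hp, hq]

/-- A polynomial vanishing on a product of infinite sets is zero, so the open negative orthant
suffices to test a homogeneous component. Negative `τ` makes the red weights positive. -/
theorem exists_mem_support_degree_eq_iff {σ : Type*} (P : MvPolynomial σ ℝ) (k : ℕ) :
    (∃ m ∈ P.support, m.degree = k) ↔ ∃ τ : σ → ℝ, (∀ e, τ e < 0) ∧
      (aeval (fun e => Polynomial.C (τ e) * Polynomial.X) P).coeff k ≠ 0 := by
  classical
  have h1 : (∃ m ∈ P.support, m.degree = k) ↔ homogeneousComponent k P ≠ 0 := by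
    rw [← support_nonempty, support_homogeneousComponent]
    simp [Finset.Nonempty]
  rw [h1]
  simp only [coeff_aeval_C_mul_X]
  constructor
  · intro h
    by_contra! h2
    refine h (funext_set (fun _ => Set.Iio 0) (fun _ => Set.Iio_infinite 0) fun τ hτ => ?_)
    rw [h2 τ fun e => hτ e trivial, map_zero]
  · rintro ⟨τ, -, h⟩ h0
    simp [h0] at h

theorem eval_aeval_C_mul_X {σ : Type*} (P : MvPolynomial σ ℝ) (τ : σ → ℝ) (x : ℝ) :
    (aeval (fun e => Polynomial.C (τ e) * Polynomial.X) P).eval x =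
      eval (fun e => x * τ e) P := by
  rw [← Polynomial.coe_evalRingHom, aeval_def, ← coe_eval₂Hom, ← RingHom.comp_apply,
    comp_eval₂Hom, coe_eval₂Hom, eval, coe_eval₂Hom]
  congr 1
  · ext r
    simp
  · ext e
    simp [mul_comm x]

end MvPolynomial

-- If `A * B = 0` then `(X - A)(X - B) = X (X - (A + B))`; take determinants.
open Polynomial in
theorem Matrix.charpoly_mul_charpoly_of_mul_eq_zero {n R : Type*} [Fintype n] [DecidableEq n]
    [CommRing R] {A B : Matrix n n R} (h : A * B = 0) :
    A.charpoly * B.charpoly = X ^ Fintype.card n * (A + B).charpoly := by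
  have h1 : A.charmatrix * B.charmatrix = (X : R[X]) • (A + B).charmatrix := by
    have h2 : A.map C * B.map C = 0 := by rw [← Matrix.map_mul, h]; simp
    simp only [charmatrix, RingHom.mapMatrix_apply, Matrix.map_add _ (map_add C), scalar_apply,
      ← smul_one_eq_diagonal, Matrix.sub_mul, Matrix.mul_sub, h2,
      Matrix.smul_mul, Matrix.mul_smul, Matrix.one_mul, Matrix.mul_one, smul_sub, smul_add,
      smul_smul]
    abel
  rw [charpoly, charpoly, ← det_mul, h1, det_smul, charpoly]

/-! ### Kernel and rank of weighted Laplacians -/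

namespace WeightedGraph

variable {V : Type*} [Fintype V] [DecidableEq V]

theorem laplacian_mulVec_apply (Γ : WeightedGraph V) (x : V → ℝ) (i : V) :
    (Γ.laplacian *ᵥ x) i = ∑ j, Γ.weight i j * (x j - x i) := by
  rw [mulVec, dotProduct, ← Finset.add_sum_erase _ _ (Finset.mem_univ i),
    ← Finset.add_sum_erase _ (fun j => Γ.weight i j * (x j - x i)) (Finset.mem_univ i)]
  simp only [laplacian, of_apply, if_true, sub_self, mul_zero, zero_add, neg_mul, Finset.sum_mul,
    ← Finset.sum_neg_distrib, ← Finset.sum_add_distrib]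
  refine Finset.sum_congr rfl fun j hj => ?_
  rw [if_neg (Finset.ne_of_mem_erase hj).symm]
  ring

theorem dotProduct_neg_laplacian_mulVec (Γ : WeightedGraph V) (x : V → ℝ) :
    x ⬝ᵥ (-Γ.laplacian *ᵥ x) = (∑ i, ∑ j, Γ.weight i j * (x i - x j) ^ 2) / 2 := by
  have h1 : x ⬝ᵥ (-Γ.laplacian *ᵥ x) = ∑ i, ∑ j, Γ.weight i j * (x i * (x i - x j)) := by
    simp only [neg_mulVec, dotProduct, Pi.neg_apply, laplacian_mulVec_apply,
      ← Finset.sum_neg_distrib, Finset.mul_sum]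
    refine Finset.sum_congr rfl fun i _ => Finset.sum_congr rfl fun j _ => by ring
  have h2 : x ⬝ᵥ (-Γ.laplacian *ᵥ x) = ∑ i, ∑ j, Γ.weight i j * (x j * (x j - x i)) := by
    rw [h1, Finset.sum_comm]
    refine Finset.sum_congr rfl fun i _ => Finset.sum_congr rfl fun j _ => by rw [Γ.symm]
  rw [eq_div_iff two_ne_zero, mul_two]
  nth_rw 1 [h1]
  rw [h2]
  simp only [← Finset.sum_add_distrib]
  refine Finset.sum_congr rfl fun i _ => Finset.sum_congr rfl fun j _ => by ring

theorem laplacian_transpose (Γ : WeightedGraph V) : Γ.laplacianᵀ = Γ.laplacian := by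
  ext i j
  rcases eq_or_ne i j with rfl | h
  · rfl
  · simp [laplacian, h, h.symm, Γ.symm i j]

theorem posSemidef_neg_laplacian (Γ : WeightedGraph V) (h : ∀ i j, 0 ≤ Γ.weight i j) :
    (-Γ.laplacian).PosSemidef := by
  refine .of_dotProduct_mulVec_nonneg ?_ fun x => ?_
  · rw [IsHermitian, conjTranspose_eq_transpose_of_trivial, transpose_neg, laplacian_transpose]
  · rw [star_trivial, dotProduct_neg_laplacian_mulVec]
    exact div_nonneg (Finset.sum_nonneg fun i _ => Finset.sum_nonneg fun j _ =>
      mul_nonneg (h i j) (sq_nonneg _)) zero_le_two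

theorem dotProduct_neg_laplacian_mulVec_eq_zero_iff (Γ : WeightedGraph V)
    (h : ∀ i j, 0 ≤ Γ.weight i j) (x : V → ℝ) :
    x ⬝ᵥ (-Γ.laplacian *ᵥ x) = 0 ↔ ∀ i j, Γ.weight i j ≠ 0 → x i = x j := by
  have hn : ∀ i j, 0 ≤ Γ.weight i j * (x i - x j) ^ 2 := fun i j =>
    mul_nonneg (h i j) (sq_nonneg _)
  rw [dotProduct_neg_laplacian_mulVec, div_eq_zero_iff, or_iff_left two_ne_zero,
    Finset.sum_eq_zero_iff_of_nonneg fun i _ => Finset.sum_nonneg fun j _ => hn i j]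
  simp only [Finset.sum_eq_zero_iff_of_nonneg fun j _ => hn _ j, Finset.mem_univ, true_imp_iff,
    mul_eq_zero, pow_eq_zero_iff two_ne_zero, sub_eq_zero, or_iff_not_imp_left]

/-- For nonnegative weights the form vanishes exactly on functions constant along edges, whatever
the weights, so components can be counted by the unweighted Laplacian. -/
theorem ker_neg_laplacian (Γ : WeightedGraph V) (h : ∀ i j, 0 ≤ Γ.weight i j)
    (H : SimpleGraph V) [DecidableRel H.Adj]
    (hH : ∀ i j, i ≠ j → (Γ.weight i j ≠ 0 ↔ H.Adj i j)) :
    LinearMap.ker (-Γ.laplacian).mulVecLin = LinearMap.ker (H.lapMatrix ℝ).mulVecLin := by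
  ext x
  rw [LinearMap.mem_ker, LinearMap.mem_ker, mulVecLin_apply, mulVecLin_apply,
    ← (Γ.posSemidef_neg_laplacian h).dotProduct_mulVec_zero_iff, star_trivial,
    dotProduct_neg_laplacian_mulVec_eq_zero_iff Γ h,
    SimpleGraph.lapMatrix_mulVec_eq_zero_iff_forall_adj]
  refine forall₂_congr fun i j => ?_
  rcases eq_or_ne i j with rfl | hij
  · simp
  · rw [hH i j hij]

theorem finrank_ker_neg_laplacian (Γ : WeightedGraph V) (h : ∀ i j, 0 ≤ Γ.weight i j)
    (H : SimpleGraph V) (hH : ∀ i j, i ≠ j → (Γ.weight i j ≠ 0 ↔ H.Adj i j)) :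
    Module.finrank ℝ (LinearMap.ker (-Γ.laplacian).mulVecLin) = componentCount H := by
  classical
  rw [ker_neg_laplacian Γ h H hH, componentCount, Nat.card_eq_fintype_card,
    SimpleGraph.card_connectedComponent_eq_finrank_ker_toLin'_lapMatrix]
  rfl

theorem rank_neg_laplacian_add (Γ : WeightedGraph V) (h : ∀ i j, 0 ≤ Γ.weight i j)
    (H : SimpleGraph V) (hH : ∀ i j, i ≠ j → (Γ.weight i j ≠ 0 ↔ H.Adj i j)) :
    (-Γ.laplacian).rank + componentCount H = Fintype.card V := by
  rw [← finrank_ker_neg_laplacian Γ h H hH, rank, LinearMap.finrank_range_add_finrank_ker,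
    Module.finrank_fintype_fun_eq_card]

/-- The Laplacian made invertible on the constants. -/
noncomputable def shifted (Γ : WeightedGraph V) : Matrix V V ℝ :=
  -Γ.laplacian + vecMulVec 1 1

theorem dotProduct_shifted_mulVec (Γ : WeightedGraph V) (x : V → ℝ) :
    x ⬝ᵥ (Γ.shifted *ᵥ x) = x ⬝ᵥ (-Γ.laplacian *ᵥ x) + (∑ i, x i) ^ 2 := by
  rw [shifted, add_mulVec, dotProduct_add, vecMulVec_mulVec]
  simp [dotProduct, sq, Finset.sum_mul]

theorem posSemidef_shifted (Γ : WeightedGraph V) (h : ∀ i j, 0 ≤ Γ.weight i j) :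
    Γ.shifted.PosSemidef := by
  refine (Γ.posSemidef_neg_laplacian h).add ?_
  simpa using posSemidef_vecMulVec_self_star (1 : V → ℝ)

theorem dotProduct_shifted_mulVec_eq_zero_iff (Γ : WeightedGraph V)
    (h : ∀ i j, 0 ≤ Γ.weight i j) (x : V → ℝ) :
    x ⬝ᵥ (Γ.shifted *ᵥ x) = 0 ↔ x ⬝ᵥ (-Γ.laplacian *ᵥ x) = 0 ∧ ∑ i, x i = 0 := by
  rw [dotProduct_shifted_mulVec, add_eq_zero_iff_of_nonneg _ (sq_nonneg _),
    pow_eq_zero_iff two_ne_zero]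
  simpa using (Γ.posSemidef_neg_laplacian h).dotProduct_mulVec_nonneg x

theorem posDef_shifted (Γ : WeightedGraph V) (h : ∀ i j, 0 ≤ Γ.weight i j)
    (H : SimpleGraph V) (hH : ∀ i j, H.Adj i j → Γ.weight i j ≠ 0) (hc : H.Connected) :
    Γ.shifted.PosDef := by
  refine .of_dotProduct_mulVec_pos (Γ.posSemidef_shifted h).1 fun x hx => ?_
  rw [star_trivial]
  refine lt_of_le_of_ne (by simpa using (Γ.posSemidef_shifted h).dotProduct_mulVec_nonneg x)
    fun h0 => hx ?_
  obtain ⟨h1, h2⟩ := (Γ.dotProduct_shifted_mulVec_eq_zero_iff h x).1 h0.symm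
  rw [dotProduct_neg_laplacian_mulVec_eq_zero_iff Γ h] at h1
  have hr : ∀ i j, x i = x j := fun i j => by
    obtain ⟨w⟩ := hc.preconnected i j
    induction w with
    | nil => rfl
    | cons ha _ ih => exact (h1 _ _ (hH _ _ ha)).trans ih
  ext i
  have : Nonempty V := ⟨i⟩
  rw [Finset.sum_congr rfl fun j _ => hr j i] at h2
  simpa using h2

/-- The kernel consists of the zero-sum vectors in the kernel of `-L`. The latter contains the
constants, so the sum functional is onto and the dimension drops by exactly one. -/
theorem rank_shifted_add [Nonempty V] (Γ : WeightedGraph V) (h : ∀ i j, 0 ≤ Γ.weight i j)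
    (H : SimpleGraph V) (hH : ∀ i j, i ≠ j → (Γ.weight i j ≠ 0 ↔ H.Adj i j)) :
    Γ.shifted.rank + componentCount H = Fintype.card V + 1 := by
  set K := LinearMap.ker (-Γ.laplacian).mulVecLin with hK
  set f : (V → ℝ) →ₗ[ℝ] ℝ := ∑ i, LinearMap.proj i with hf
  have hfx : ∀ x, f x = ∑ i, x i := fun x => by simp [hf]
  have hker : LinearMap.ker Γ.shifted.mulVecLin =
      (LinearMap.ker (f.domRestrict K)).map K.subtype := by
    ext x
    rw [LinearMap.mem_ker, mulVecLin_apply, ← (Γ.posSemidef_shifted h).dotProduct_mulVec_zero_iff,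
      star_trivial, dotProduct_shifted_mulVec_eq_zero_iff Γ h, ← hfx]
    have hx : x ⬝ᵥ (-Γ.laplacian *ᵥ x) = 0 ↔ x ∈ K := by
      rw [hK, LinearMap.mem_ker, mulVecLin_apply,
        ← (Γ.posSemidef_neg_laplacian h).dotProduct_mulVec_zero_iff, star_trivial]
    rw [hx]
    simp [and_comm]
  have hone : (1 : V → ℝ) ∈ K := by
    rw [hK, LinearMap.mem_ker, mulVecLin_apply,
      ← (Γ.posSemidef_neg_laplacian h).dotProduct_mulVec_zero_iff, star_trivial,
      dotProduct_neg_laplacian_mulVec_eq_zero_iff Γ h]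
    simp
  have hsurj : LinearMap.range (f.domRestrict K) = ⊤ := by
    refine LinearMap.range_eq_top.2 (LinearMap.surjective fun h0 => ?_)
    have := LinearMap.congr_fun h0 ⟨1, hone⟩
    simp [hfx] at this
  have h1 := LinearMap.finrank_range_add_finrank_ker (f.domRestrict K)
  rw [hsurj, finrank_top, Module.finrank_self,
    show Module.finrank ℝ K = _ from finrank_ker_neg_laplacian Γ h H hH] at h1
  have h2 := LinearMap.finrank_range_add_finrank_ker Γ.shifted.mulVecLin
  rw [hker, Submodule.finrank_map_subtype_eq, Module.finrank_fintype_fun_eq_card] at h2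
  rw [rank]
  omega

open Polynomial in
theorem crossing_eq [Nonempty V] (Γ : WeightedGraph V) :
    Γ.crossing = Γ.shifted.det / (Fintype.card V : ℝ) ^ 2 := by
  set p := Γ.laplacian.charpoly with hp
  set r := ((Γ.eigenvalues.erase 0).map fun a => X - C a).prod with hr
  have hL1 : Γ.laplacian *ᵥ 1 = 0 := by
    ext i
    simp [laplacian_mulVec_apply]
  have hH : Γ.laplacian.IsHermitian := by
    rw [IsHermitian, conjTranspose_eq_transpose_of_trivial, laplacian_transpose]
  have h0 : (0 : ℝ) ∈ Γ.eigenvalues := by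
    rw [eigenvalues, mem_roots (charpoly_monic _).ne_zero, IsRoot, eval_charpoly, map_zero,
      zero_sub, ← exists_mulVec_eq_zero_iff]
    exact ⟨1, one_ne_zero, by rw [neg_mulVec, hL1, neg_zero]⟩
  have hpr : p = X * r := by
    rw [hp, hH.splits_charpoly.eq_prod_roots_of_monic (charpoly_monic _),
      show Γ.laplacian.charpoly.roots = 0 ::ₘ Γ.eigenvalues.erase 0 from
        (Multiset.cons_erase h0).symm, Multiset.map_cons, Multiset.prod_cons, map_zero, sub_zero]
  have hcard : Multiset.card (Γ.eigenvalues.erase 0) = Fintype.card V - 1 := by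
    rw [Multiset.card_erase_of_mem h0, eigenvalues,
      ← hH.splits_charpoly.natDegree_eq_card_roots, charpoly_natDegree_eq_dim, Nat.pred_eq_sub_one]
  -- Here `B = -J`, with characteristic polynomial `X ^ (N - 1) * (X + N)`; cancelling `X ^ N` shows
  -- that `L - J` has eigenvalue `-N` in place of one `0`.
  have hmul := charpoly_mul_charpoly_of_mul_eq_zero (A := Γ.laplacian)
    (B := vecMulVec (-1) 1) (by rw [mul_vecMulVec, mulVec_neg, hL1, neg_zero, zero_vecMulVec])
  have hN : Fintype.card V - 1 + 1 = Fintype.card V := Nat.sub_add_cancel Fintype.card_pos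
  have hkey : r * (X + C (Fintype.card V : ℝ)) =
      (Γ.laplacian + vecMulVec (-1) 1).charpoly := by
    refine mul_left_cancel₀ (pow_ne_zero (Fintype.card V) (X_ne_zero (R := ℝ))) ?_
    rw [← hmul, charpoly_vecMulVec, ← hp, hpr, ← hN, smul_eq_C_mul]
    simp only [neg_dotProduct, one_dotProduct_one, map_neg, hN]
    nth_rw 1 3 [← hN]
    ring
  have hdet : Γ.shifted.det = (-1) ^ (Fintype.card V - 1) * (Γ.eigenvalues.erase 0).prod *
      Fintype.card V := by
    have h1 := congrArg (eval 0) hkey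
    rw [eval_charpoly, eval_mul, hr, eval_multiset_prod, Multiset.map_map] at h1
    have h2 : Γ.shifted = scalar V (0 : ℝ) - (Γ.laplacian + vecMulVec (-1) 1) := by
      rw [shifted, map_zero, neg_vecMulVec]
      abel
    rw [h2, ← h1, ← hcard, ← Multiset.prod_map_neg]
    simp
  have hne : (Fintype.card V : ℝ) ≠ 0 := Nat.cast_ne_zero.2 Fintype.card_ne_zero
  rw [crossing, hdet]
  field_simp

end WeightedGraph

/-! ### The pencil of a signed graph -/

namespace SignedGraph

variable {V : Type*}

theorem edgeWeight_add_mul (G : SignedGraph V) (s : G.EdgeOf .black → ℝ)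
    (t : G.EdgeOf .red → ℝ) (x : ℝ) (e : Sym2 V) :
    G.edgeWeight s (fun e => x * t e) e = G.edgeWeight s 0 e + x * G.edgeWeight 0 t e := by
  unfold edgeWeight
  split_ifs with h
  · split <;> simp
  · simp

theorem edgeWeight_nonneg (G : SignedGraph V) {s : G.EdgeOf .black → ℝ}
    {t : G.EdgeOf .red → ℝ} (hs : ∀ e, 0 ≤ s e) (ht : ∀ e, t e ≤ 0) (e : Sym2 V) :
    0 ≤ G.edgeWeight s t e := by
  unfold edgeWeight
  split_ifs with h
  · split
    · exact hs _
    · exact neg_nonneg.2 (ht _)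
  · exact le_rfl

theorem edgeWeight_ne_zero_of_mem (G : SignedGraph V) {s : G.EdgeOf .black → ℝ}
    {t : G.EdgeOf .red → ℝ} (hs : ∀ e, s e ≠ 0) (ht : ∀ e, t e ≠ 0) {e : Sym2 V}
    (he : e ∈ G.graph.edgeSet) : G.edgeWeight s t e ≠ 0 := by
  unfold edgeWeight
  rw [dif_pos he]
  split
  · exact hs _
  · exact neg_ne_zero.2 (ht _)

theorem edgeWeight_black_ne_zero_iff (G : SignedGraph V) {s : G.EdgeOf .black → ℝ}
    (hs : ∀ e, s e ≠ 0) (i j : V) : G.edgeWeight s 0 s(i, j) ≠ 0 ↔ G.plus.Adj i j := by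
  change _ ↔ ∃ h : s(i, j) ∈ G.graph.edgeSet, G.color ⟨s(i, j), h⟩ = .black
  unfold edgeWeight
  split_ifs with h
  · split
    · next hc => exact iff_of_true (hs _) ⟨h, hc⟩
    · next hc => simp [hc]
  · simp [h]

theorem edgeWeight_red_ne_zero_iff (G : SignedGraph V) {t : G.EdgeOf .red → ℝ}
    (ht : ∀ e, t e ≠ 0) (i j : V) : G.edgeWeight 0 t s(i, j) ≠ 0 ↔ G.minus.Adj i j := by
  change _ ↔ ∃ h : s(i, j) ∈ G.graph.edgeSet, G.color ⟨s(i, j), h⟩ = .red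
  unfold edgeWeight
  split_ifs with h
  · split
    · next hc => simp [hc]
    · next hc => exact iff_of_true (neg_ne_zero.2 (ht _)) ⟨h, hc⟩
  · simp [h]

open Classical in
/-- The weight of a pair of vertices as a polynomial in the red variables. -/
noncomputable def edgePolynomial (G : SignedGraph V) (s : G.EdgeOf .black → ℝ) (e : Sym2 V) :
    MvPolynomial (G.EdgeOf .red) ℝ :=
  if h : e ∈ G.graph.edgeSet then
    match hc : G.color ⟨e, h⟩ with
    | .black => .C (s ⟨⟨e, h⟩, hc⟩)
    | .red => -.X ⟨⟨e, h⟩, hc⟩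
  else 0

theorem eval_edgePolynomial (G : SignedGraph V) (s : G.EdgeOf .black → ℝ)
    (t : G.EdgeOf .red → ℝ) (e : Sym2 V) :
    MvPolynomial.eval t (G.edgePolynomial s e) = G.edgeWeight s t e := by
  unfold edgePolynomial edgeWeight
  split_ifs with h
  · split <;> simp
  · simp

variable [Fintype V] [DecidableEq V]

theorem shifted_toWeightedGraph (G : SignedGraph V) (s : G.EdgeOf .black → ℝ)
    (t : G.EdgeOf .red → ℝ) (x : ℝ) :
    (G.toWeightedGraph s fun e => x * t e).shifted =
      (G.toWeightedGraph s 0).shifted + x • -(G.toWeightedGraph 0 t).laplacian := by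
  have h : (G.toWeightedGraph s fun e => x * t e).laplacian =
      (G.toWeightedGraph s 0).laplacian + x • (G.toWeightedGraph 0 t).laplacian := by
    ext i j
    by_cases hij : i = j
    · simp [WeightedGraph.laplacian, hij, toWeightedGraph, edgeWeight_add_mul,
        Finset.sum_add_distrib, ← Finset.mul_sum]
      ring
    · simp [WeightedGraph.laplacian, hij, toWeightedGraph, edgeWeight_add_mul]
  rw [WeightedGraph.shifted, WeightedGraph.shifted, h, smul_neg]
  abel

/-- The shifted Laplacian with polynomial entries. -/
noncomputable def shiftedPolynomial (G : SignedGraph V) (s : G.EdgeOf .black → ℝ) :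
    Matrix V V (MvPolynomial (G.EdgeOf .red) ℝ) :=
  of fun i j => (if i = j then ∑ k ∈ Finset.univ.erase i, G.edgePolynomial s s(i, k)
    else -G.edgePolynomial s s(i, j)) + 1

theorem eval_det_shiftedPolynomial (G : SignedGraph V) (s : G.EdgeOf .black → ℝ)
    (t : G.EdgeOf .red → ℝ) :
    MvPolynomial.eval t (G.shiftedPolynomial s).det = (G.toWeightedGraph s t).shifted.det := by
  rw [RingHom.map_det]
  congr 1
  ext i j
  by_cases hij : i = j <;>
    simp [shiftedPolynomial, WeightedGraph.shifted, WeightedGraph.laplacian, hij,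
      toWeightedGraph, eval_edgePolynomial]

theorem exists_isCrossingPolynomial [Nonempty V] (G : SignedGraph V)
    (s : G.EdgeOf .black → ℝ) : ∃ P, G.IsCrossingPolynomial s P :=
  ⟨.C ((Fintype.card V : ℝ) ^ 2)⁻¹ * (G.shiftedPolynomial s).det, fun t => by
    rw [map_mul, MvPolynomial.eval_C, eval_det_shiftedPolynomial, WeightedGraph.crossing_eq,
      div_eq_inv_mul]⟩

theorem IsCrossingPolynomial.coeff_ne_zero_iff {G : SignedGraph V} (hG : G.graph.Connected)
    {s : G.EdgeOf .black → ℝ} (hs : ∀ e, 0 < s e) {P : MvPolynomial (G.EdgeOf .red) ℝ}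
    (hP : G.IsCrossingPolynomial s P) {τ : G.EdgeOf .red → ℝ} (hτ : ∀ e, τ e < 0) (k : ℕ) :
    (MvPolynomial.aeval (fun e => Polynomial.C (τ e) * Polynomial.X) P).coeff k ≠ 0 ↔
      componentCount G.plus ≤ k + 1 ∧ k + componentCount G.minus ≤ Fintype.card V := by
  have := hG.nonempty
  set A := (G.toWeightedGraph s 0).shifted with hA
  set B := -(G.toWeightedGraph 0 τ).laplacian with hB
  have hs0 : ∀ i j, 0 ≤ (G.toWeightedGraph s 0).weight i j := fun i j =>
    G.edgeWeight_nonneg (fun e => (hs e).le) (fun e => le_rfl) _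
  have ht0 : ∀ i j, 0 ≤ (G.toWeightedGraph 0 τ).weight i j := fun i j =>
    G.edgeWeight_nonneg (fun e => le_rfl) (fun e => (hτ e).le) _
  -- At `x = 1` the pencil is the shifted Laplacian of the connected graph `G` with all weights
  -- positive.
  have hsum : (A + B).PosDef := by
    have h := G.shifted_toWeightedGraph s τ 1
    simp only [one_mul, one_smul] at h
    rw [← h]
    exact (G.toWeightedGraph s τ).posDef_shifted
      (fun i j => G.edgeWeight_nonneg (fun e => (hs e).le) (fun e => (hτ e).le) _) G.graph
      (fun i j hij => G.edgeWeight_ne_zero_of_mem (fun e => (hs e).ne') (fun e => (hτ e).ne) hij)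
      hG
  obtain ⟨q, hq, hqc⟩ := (WeightedGraph.posSemidef_shifted _ hs0).exists_polynomial_det_add_smul
    (WeightedGraph.posSemidef_neg_laplacian _ ht0) hsum
  have hN : ((Fintype.card V : ℝ) ^ 2)⁻¹ ≠ 0 :=
    inv_ne_zero (pow_ne_zero _ (Nat.cast_ne_zero.2 Fintype.card_ne_zero))
  have hPq : MvPolynomial.aeval (fun e => Polynomial.C (τ e) * Polynomial.X) P =
      Polynomial.C ((Fintype.card V : ℝ) ^ 2)⁻¹ * q := by
    refine Polynomial.funext fun x => ?_
    rw [MvPolynomial.eval_aeval_C_mul_X, hP, WeightedGraph.crossing_eq, shifted_toWeightedGraph,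
      Polynomial.eval_mul, Polynomial.eval_C, hq, div_eq_inv_mul]
  have h1 := (G.toWeightedGraph s 0).rank_shifted_add hs0 G.plus
    fun i j _ => G.edgeWeight_black_ne_zero_iff (fun e => (hs e).ne') i j
  have h2 := (G.toWeightedGraph 0 τ).rank_neg_laplacian_add ht0 G.minus
    fun i j _ => G.edgeWeight_red_ne_zero_iff (fun e => (hτ e).ne) i j
  rw [hPq, Polynomial.coeff_C_mul, mul_ne_zero_iff_left hN, hqc]
  omega

end SignedGraph

theorem mainTheorem9 {V : Type*} [Fintype V] [DecidableEq V] (G : SignedGraph V)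
    (hG : G.graph.Connected) (s : G.EdgeOf .black → ℝ) (hs : ∀ e, 0 < s e) :
    (∃! P : MvPolynomial (G.EdgeOf .red) ℝ, G.IsCrossingPolynomial s P) ∧
      ∀ P : MvPolynomial (G.EdgeOf .red) ℝ, G.IsCrossingPolynomial s P →
        ∀ k : ℕ, (∃ m ∈ P.support, m.degree = k) ↔
          (componentCount G.plus : ℤ) - 1 ≤ (k : ℤ) ∧
            (k : ℤ) ≤ (Fintype.card V : ℤ) - (componentCount G.minus : ℤ) := by
  have := hG.nonempty
  refine ⟨?_, fun P hP k => ?_⟩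
  · obtain ⟨P, hP⟩ := G.exists_isCrossingPolynomial s
    exact ⟨P, hP, fun Q hQ => MvPolynomial.funext fun t => by rw [hQ t, hP t]⟩
  · have h : (∃ m ∈ P.support, m.degree = k) ↔
        componentCount G.plus ≤ k + 1 ∧ k + componentCount G.minus ≤ Fintype.card V := by
      rw [MvPolynomial.exists_mem_support_degree_eq_iff]
      constructor
      · rintro ⟨τ, hτ, h⟩
        exact (hP.coeff_ne_zero_iff hG hs hτ k).1 h
      · intro h
        -- Any negative vector would do, since the criterion is independent of `τ`.
        exact ⟨fun _ => -1, fun _ => by norm_num,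
          (hP.coeff_ne_zero_iff hG hs (fun _ => by norm_num) k).2 h⟩
    rw [h]
    omega
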